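/- For a finite generating set $S$ of a group $G$, let $\ell_{G,S}(g)$ be the minimal length of a product of elements of $S\cup S^{-1}$ equal to $g$, let $F_{G,S}(n)=\#\{g\in G : \ell_{G,S}(g)\le n\}$, and let $\omega(G,S)=\lim_{n\to\infty}F_{G,S}(n)^{1/n}$ be the exponential growth rate of $G$ with respect to $S$. For a finitely generated group $G$ let $\Omega(G)=\inf_S\omega(G,S)$, where $S$ runs over all finite generating sets of $G$. An HNN extension $H*_\theta$ relative to an isomorphism $\theta:A\to B$ between subgroups of $H$ is called non-semidirect if at least one of $A$, $B$ is a proper subgroup of $H$. Let $\mathcal L_2=(\mathbb Z/2\mathbb Z)\wr\mathbb Z=\bigl(\bigoplus_{\mathbb Z}\mathbb Z/2\mathbb Z\bigr)\rtimes\mathbb Z$ be the lamplighter group (restricted wreath product), where $\mathbb Z$ acts by translation of coordinates, let $a$ be the generator of the copy of $\mathbb Z/2\mathbb Z$ at position $0$, and let $t$ be the generator $1$ of $\mathbb Z$. Then $\{a,t\}$ generates $\mathcal L_2$, the minimal growth rate of $\mathcal L_2$ is attained on $\{a,t\}$, and it equals the golden ratio: $$\Omega(\mathcal L_2)=\omega(\mathcal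 L_2,\{a,t\})=\frac{1+\sqrt5}{2}.$$ Moreover, $\mathcal L_2$ is isomorphic to a non-semidirect HNN extension. Consequently the constant $\frac{1+\sqrt5}{2}$ in Mann's lower bound $\Omega(G)\ge\frac{1+\sqrt5}{2}$ for finitely generated non-semidirect HNN extensions $G$ is optimal: if a real number $c$ satisfies $c\le\Omega(G)$ for every finitely generated non-semidirect HNN extension $G$, then $c\le\frac{1+\sqrt5}{2}$. -/

import Mathlib

open Filter Topology

section Growth

variable {G : Type*} [Group G]

/-- The length of `g` with respect to `S`: the minimal length of a product of elements of
`S ∪ S⁻¹` that equals `g` (it is `⊤` if there is no such product). -/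
noncomputable def wordLength (S : Set G) (g : G) : ℕ∞ :=
  ⨅ l : {l : List G // (∀ x ∈ l, x ∈ S ∨ x⁻¹ ∈ S) ∧ l.prod = g}, (l.1.length : ℕ∞)

/-- The growth function: the number of elements in the ball of radius `n` around the identity. -/
noncomputable def growthFunction (S : Set G) (n : ℕ) : ℕ :=
  Nat.card {g : G // wordLength S g ≤ n}

/-- The exponential growth rate `ω(G, S) = lim F(n)^(1/n)`; the limit exists for every finite `S`,
see `tendsto_growthRate`. -/
noncomputable def growthRate (S : Set G) : ℝ :=
  limUnder atTop fun n : ℕ => (growthFunction S n : ℝ) ^ (1 / (n : ℝ))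

/-- The minimal growth rate `Ω(G)`: the infimum of `ω(G, S)` over all finite generating sets. -/
noncomputable def minimalGrowthRate (G : Type*) [Group G] : ℝ :=
  sInf {r : ℝ | ∃ S : Set G, S.Finite ∧ Subgroup.closure S = ⊤ ∧ growthRate S = r}

theorem wordLength_le_iff (S : Set G) (g : G) (n : ℕ) :
    wordLength S g ≤ n ↔
      ∃ l : List G, (∀ x ∈ l, x ∈ S ∨ x⁻¹ ∈ S) ∧ l.prod = g ∧ l.length ≤ n := by
  constructor
  · intro h
    have h' : wordLength S g < ((n + 1 : ℕ) : ℕ∞) :=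
      lt_of_le_of_lt h (by exact_mod_cast Nat.lt_succ_self n)
    obtain ⟨⟨l, hl, hg⟩, hlt⟩ := iInf_lt_iff.1 h'
    exact ⟨l, hl, hg, Nat.lt_succ_iff.1 (by exact_mod_cast hlt)⟩
  · rintro ⟨l, hl, hg, hn⟩
    exact (iInf_le _ (⟨l, hl, hg⟩ : {l : List G // (∀ x ∈ l, x ∈ S ∨ x⁻¹ ∈ S) ∧ l.prod = g})).trans
      (by exact_mod_cast hn)

theorem finite_ball {S : Set G} (hS : S.Finite) (n : ℕ) :
    Finite {g : G // wordLength S g ≤ n} := by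
  have hT : (S ∪ S⁻¹).Finite := hS.union hS.inv
  have : Finite ↥(S ∪ S⁻¹) := hT
  have hfin := List.finite_length_le (↥(S ∪ S⁻¹)) n
  refine ((hfin.image fun l => (l.map Subtype.val).prod).subset ?_ :
    Set.Finite {g | wordLength S g ≤ n})
  intro g hg
  obtain ⟨l, hl, hp, hn⟩ := (wordLength_le_iff S g n).1 hg
  refine ⟨l.attach.map fun x => ⟨x.1, hl x.1 x.2⟩, ?_, ?_⟩
  · simpa using hn
  · simpa [List.map_map, Function.comp_def] using hp

theorem growthFunction_pos {S : Set G} (hS : S.Finite) (n : ℕ) : 0 < growthFunction S n := by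
  have := finite_ball hS n
  have : Nonempty {g : G // wordLength S g ≤ n} :=
    ⟨1, (wordLength_le_iff S 1 n).2 ⟨[], by simp⟩⟩
  exact Nat.card_pos

theorem growthFunction_add_le {S : Set G} (hS : S.Finite) (m n : ℕ) :
    growthFunction S (m + n) ≤ growthFunction S m * growthFunction S n := by
  have := finite_ball hS m
  have := finite_ball hS n
  unfold growthFunction
  rw [← Nat.card_prod]
  have key : ∀ g : {g : G // wordLength S g ≤ (m + n : ℕ)},
      ∃ p : {g : G // wordLength S g ≤ m} × {g : G // wordLength S g ≤ n},
        p.1.1 * p.2.1 = g.1 := by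
    rintro ⟨g, hg⟩
    obtain ⟨l, hl, hp, hn⟩ := (wordLength_le_iff S g _).1 hg
    refine ⟨⟨⟨(l.take m).prod, (wordLength_le_iff S _ m).2
      ⟨_, fun x hx => hl x (List.mem_of_mem_take hx), rfl, by simp⟩⟩,
      ⟨(l.drop m).prod, (wordLength_le_iff S _ n).2
      ⟨_, fun x hx => hl x (List.mem_of_mem_drop hx), rfl, by simp; omega⟩⟩⟩, ?_⟩
    simpa [← List.prod_append] using hp
  choose f hf using key
  refine Nat.card_le_card_of_injective f fun x y hxy => Subtype.ext ?_
  rw [← hf x, ← hf y, hxy]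

/-- The limit in the definition of the exponential growth rate exists. -/
theorem tendsto_growthRate {S : Set G} (hS : S.Finite) :
    Tendsto (fun n : ℕ => (growthFunction S n : ℝ) ^ (1 / (n : ℝ))) atTop (𝓝 (growthRate S)) := by
  have hpos : ∀ n, (0 : ℝ) < growthFunction S n := fun n => by
    exact_mod_cast growthFunction_pos hS n
  have hsub : Subadditive fun n => Real.log (growthFunction S n) := fun m n => by
    rw [← Real.log_mul (hpos m).ne' (hpos n).ne']
    exact Real.log_le_log (hpos _) (by exact_mod_cast growthFunction_add_le hS m n)
  have hlim := hsub.tendsto_lim ⟨0, by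
    rintro _ ⟨n, rfl⟩
    refine div_nonneg (Real.log_nonneg ?_) (Nat.cast_nonneg n)
    exact_mod_cast growthFunction_pos hS n⟩
  refine tendsto_nhds_limUnder ⟨Real.exp hsub.lim, ?_⟩
  refine ((Real.continuous_exp.tendsto _).comp hlim).congr fun n => ?_
  rw [Function.comp_apply, Real.rpow_def_of_pos (hpos n), mul_one_div]

end Growth

section HNN

universe u

/-- `G` is a non-semidirect HNN extension: it is isomorphic to an HNN extension of a group `H`
relative to an isomorphism `θ : A ≃* B` of subgroups of `H`, at least one of which is proper. -/
def IsNonSemidirectHNN (G : Type u) [Group G] : Prop :=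
  ∃ (H : Type u) (_ : Group H) (A B : Subgroup H) (θ : A ≃* B),
    (A ≠ ⊤ ∨ B ≠ ⊤) ∧ Nonempty (G ≃* HNNExtension H A B θ)

end HNN

namespace Lamplighter

/-- The action of `ℤ` on finitely supported lamp configurations by translation:
`(shift k f) i = f (i - k)`. -/
noncomputable def shift (n : ℕ) : Multiplicative ℤ →* MulAut (Multiplicative (ℤ →₀ ZMod n)) where
  toFun k := AddEquiv.toMultiplicative (Finsupp.domCongr (Equiv.addLeft k.toAdd))
  map_one' := by
    ext f : 1
    apply Multiplicative.toAdd.injective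
    ext i
    simp [Finsupp.domCongr_apply, Finsupp.equivMapDomain_apply]
    rfl
  map_mul' k l := by
    ext f : 1
    apply Multiplicative.toAdd.injective
    ext i
    simp [Finsupp.domCongr_apply, Finsupp.equivMapDomain_apply]
    rfl

end Lamplighter

/-- The lamplighter group: the restricted wreath product `(ℤ/nℤ) ≀ ℤ`. -/
abbrev Lamplighter (n : ℕ) : Type :=
  Multiplicative (ℤ →₀ ZMod n) ⋊[Lamplighter.shift n] Multiplicative ℤ

namespace Lamplighter

/-- The canonical generator `a`: the generator of the copy of `ℤ/nℤ` at position `0`. -/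
noncomputable def a (n : ℕ) : Lamplighter n :=
  SemidirectProduct.inl (Multiplicative.ofAdd (Finsupp.single 0 1))

/-- The canonical generator `t`: the generator of `ℤ`. -/
noncomputable def t (n : ℕ) : Lamplighter n :=
  SemidirectProduct.inr (Multiplicative.ofAdd 1)

end Lamplighter

/-!
The value of `ω` on `{a, t}` is squeezed by two counts in which `φ⁻¹ + φ⁻² = 1` plays the decisive
role. From above: a word of length at most `m` visits an interval of positions and spends one letter
on each move and one on each lamp that it leaves lit. Weighing such patterns on an interval of `ℓ`
positions with total weight `(φ⁻¹ + φ⁻²) ^ ℓ = 1` bounds their number by `φ ^ (m + 1)`, on each of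
the polynomially many intervals. From below: every generating set contains two noncommuting
elements, which after inversions are some `x` moving to the right and some `y` not moving to the
left. Looking at the leftmost lamp of the commutator `⁅x * y, x⁆` one sees that `x` and `x * y`, of
lengths at most `1` and `2`, freely generate a monoid, whose growth rate is at least the root `φ` of
`r⁻¹ + r⁻² = 1`.

Conjugation by `t` maps the lamp configurations on the nonnegative positions onto a proper
subgroup of them. No nontrivial power of `t` is such a configuration, for it would then normalize
the group of all of them; hence `t` and these configurations form an ascending HNN extension.
-/

section GrowthBounds

open scoped Pointwise

variable {G : Type*} [Group G] {S : Set G}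

/-- The ball of radius `n` in the Cayley graph of `S`, as a set; its cardinality is the growth
function. -/
def wordBall (S : Set G) (n : ℕ) : Set G := {g | wordLength S g ≤ n}

theorem growthFunction_eq_ncard (S : Set G) (n : ℕ) : growthFunction S n = (wordBall S n).ncard :=
  rfl

theorem one_mem_wordBall (S : Set G) (n : ℕ) : 1 ∈ wordBall S n :=
  (wordLength_le_iff S 1 n).2 ⟨[], by simp⟩

theorem mul_mem_wordBall {g h : G} {m n : ℕ} (hg : g ∈ wordBall S m) (hh : h ∈ wordBall S n) :
    g * h ∈ wordBall S (m + n) := by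
  obtain ⟨l, hl, rfl, hm⟩ := (wordLength_le_iff S g m).1 hg
  obtain ⟨l', hl', rfl, hn⟩ := (wordLength_le_iff S h n).1 hh
  refine (wordLength_le_iff S _ _).2 ⟨l ++ l', fun x hx => ?_, List.prod_append, ?_⟩
  · exact (List.mem_append.1 hx).elim (hl x) (hl' x)
  · rw [List.length_append]
    omega

theorem subset_wordBall_one (S : Set G) : S ⊆ wordBall S 1 := fun g hg =>
  (wordLength_le_iff S g 1).2 ⟨[g], by simpa using Or.inl hg, by simp, by simp⟩

theorem inv_mem_wordBall {g : G} {n : ℕ} (hg : g ∈ wordBall S n) : g⁻¹ ∈ wordBall S n := by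
  obtain ⟨l, hl, rfl, hn⟩ := (wordLength_le_iff S g n).1 hg
  refine (wordLength_le_iff S _ n).2 ⟨_, fun x hx => ?_, (List.prod_inv_reverse l).symm, by simpa⟩
  obtain ⟨y, hy, rfl⟩ := List.mem_map.1 (List.mem_reverse.1 hx)
  simpa using (hl y hy).symm

theorem tendsto_const_mul_pow_mul_pow_rpow_one_div {c r : ℝ} (hc : 0 < c) (hr : 0 ≤ r) (d : ℕ) :
    Tendsto (fun n : ℕ => (c * (n : ℝ) ^ d * r ^ n) ^ (1 / (n : ℝ))) atTop (𝓝 r) := by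
  have hconst : Tendsto (fun n : ℕ => c ^ (1 / (n : ℝ))) atTop (𝓝 1) := by
    simpa using (tendsto_const_nhds (x := c)).rpow tendsto_one_div_atTop_nhds_zero_nat
      (Or.inl hc.ne')
  have hroot : Tendsto (fun n : ℕ => (n : ℝ) ^ (1 / (n : ℝ))) atTop (𝓝 1) :=
    tendsto_rpow_div.comp tendsto_natCast_atTop_atTop
  have hprod : Tendsto (fun n : ℕ => c ^ (1 / (n : ℝ)) * ((n : ℝ) ^ (1 / (n : ℝ))) ^ d * r) atTop
      (𝓝 r) := by
    simpa using (hconst.mul (hroot.pow d)).mul_const r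
  refine hprod.congr' ?_
  filter_upwards [eventually_ne_atTop 0] with n hn
  rw [Real.mul_rpow (by positivity) (by positivity), Real.mul_rpow hc.le (by positivity),
    one_div, Real.pow_rpow_inv_natCast hr hn, Real.rpow_pow_comm (by positivity)]

theorem le_growthRate_of_eventually_le (hS : S.Finite) {c r : ℝ} (hc : 0 < c) (hr : 0 ≤ r) (d : ℕ)
    (h : ∀ᶠ n : ℕ in atTop, c * (n : ℝ) ^ d * r ^ n ≤ growthFunction S n) : r ≤ growthRate S := by
  refine le_of_tendsto_of_tendsto (tendsto_const_mul_pow_mul_pow_rpow_one_div hc hr d)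
    (tendsto_growthRate hS) ?_
  filter_upwards [h] with n hn
  exact Real.rpow_le_rpow (by positivity) hn (by positivity)

theorem growthRate_le_of_eventually_le (hS : S.Finite) {c r : ℝ} (hc : 0 < c) (hr : 0 ≤ r) (d : ℕ)
    (h : ∀ᶠ n : ℕ in atTop, growthFunction S n ≤ c * (n : ℝ) ^ d * r ^ n) : growthRate S ≤ r := by
  refine le_of_tendsto_of_tendsto (tendsto_growthRate hS)
    (tendsto_const_mul_pow_mul_pow_rpow_one_div hc hr d) ?_
  filter_upwards [h] with n hn
  exact Real.rpow_le_rpow (by positivity) hn (by positivity)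

variable {M : Submonoid G} {x y : G} {p q : ℕ}

theorem ncard_inter_wordBall_add_le (hS : S.Finite) (hxM : x ∈ M) (hyM : y ∈ M)
    (hdisj : Disjoint (x • (M : Set G)) (y • (M : Set G)))
    (hx : x ∈ wordBall S p) (hy : y ∈ wordBall S q) {i j n : ℕ} (hi : p + i = n) (hj : q + j = n) :
    (M ∩ wordBall S i : Set G).ncard + (M ∩ wordBall S j : Set G).ncard ≤
      (M ∩ wordBall S n : Set G).ncard := by
  have hfin (k : ℕ) : (M ∩ wordBall S k : Set G).Finite :=
    Set.Finite.inter_of_right (finite_ball hS k) _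
  calc (M ∩ wordBall S i : Set G).ncard + (M ∩ wordBall S j : Set G).ncard
      = (x • (M ∩ wordBall S i : Set G) ∪ y • (M ∩ wordBall S j : Set G)).ncard := by
        rw [Set.ncard_union_eq _ (hfin i).smul_set (hfin j).smul_set, Set.ncard_smul_set,
          Set.ncard_smul_set]
        exact hdisj.mono (Set.smul_set_mono Set.inter_subset_left)
          (Set.smul_set_mono Set.inter_subset_left)
    _ ≤ (M ∩ wordBall S n : Set G).ncard := by
        refine Set.ncard_le_ncard (Set.union_subset ?_ ?_) (hfin n)
        · rintro _ ⟨u, ⟨huM, hu⟩, rfl⟩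
          exact ⟨mul_mem hxM huM, hi ▸ mul_mem_wordBall hx hu⟩
        · rintro _ ⟨u, ⟨huM, hu⟩, rfl⟩
          exact ⟨mul_mem hyM huM, hj ▸ mul_mem_wordBall hy hu⟩

-- The right ideals `x M` and `y M` being disjoint, `x` and `y` freely generate a submonoid of `M`;
-- its elements are counted by `b (n) = b (n - p) + b (n - q)`.
theorem le_growthRate_of_disjoint_smul (hS : S.Finite) (hxM : x ∈ M) (hyM : y ∈ M)
    (hdisj : Disjoint (x • (M : Set G)) (y • (M : Set G)))
    (hx : x ∈ wordBall S p) (hy : y ∈ wordBall S q) (hp : 0 < p) (hq : 0 < q)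
    {r : ℝ} (hr : 1 ≤ r) (hpq : 1 ≤ r⁻¹ ^ p + r⁻¹ ^ q) : r ≤ growthRate S := by
  have hr0 : 0 < r := one_pos.trans_le hr
  let b (n : ℕ) : ℕ := (M ∩ wordBall S n : Set G).ncard
  have hb_pos (n : ℕ) : 0 < b n :=
    (Set.ncard_pos (Set.Finite.inter_of_right (finite_ball hS n) _)).2
      ⟨1, one_mem M, one_mem_wordBall S n⟩
  have hb (n : ℕ) : r⁻¹ ^ (p + q) * r ^ n ≤ b n := by
    induction n using Nat.strong_induction_on with
    | _ n ih =>
      rcases le_or_gt (p + q) n with hn | hn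
      · calc r⁻¹ ^ (p + q) * r ^ n ≤ r⁻¹ ^ (p + q) * r ^ n * (r⁻¹ ^ p + r⁻¹ ^ q) :=
              le_mul_of_one_le_right (by positivity) hpq
          _ = r⁻¹ ^ (p + q) * r ^ (n - p) + r⁻¹ ^ (p + q) * r ^ (n - q) := by
              rw [pow_sub₀ r hr0.ne' (by omega), pow_sub₀ r hr0.ne' (by omega)]
              simp only [inv_pow]
              ring
          _ ≤ b (n - p) + b (n - q) := add_le_add (ih _ (by omega)) (ih _ (by omega))
          _ ≤ b n := mod_cast ncard_inter_wordBall_add_le hS hxM hyM hdisj hx hy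
              (by omega) (by omega)
      · calc r⁻¹ ^ (p + q) * r ^ n ≤ r⁻¹ ^ (p + q) * r ^ (p + q) := by gcongr
          _ = 1 := by rw [← mul_pow, inv_mul_cancel₀ hr0.ne', one_pow]
          _ ≤ b n := mod_cast hb_pos n
  refine le_growthRate_of_eventually_le hS (pow_pos (inv_pos.2 hr0) (p + q)) hr0.le 0
    (Eventually.of_forall fun n => ?_)
  calc r⁻¹ ^ (p + q) * (n : ℝ) ^ 0 * r ^ n = r⁻¹ ^ (p + q) * r ^ n := by rw [pow_zero, mul_one]
    _ ≤ b n := hb n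
    _ ≤ growthFunction S n :=
      mod_cast Set.ncard_le_ncard Set.inter_subset_right (finite_ball hS n)

theorem exists_not_commute_of_closure_eq_top (hS : Subgroup.closure S = ⊤) {g h : G}
    (hgh : ¬Commute g h) : ∃ x ∈ S, ∃ y ∈ S, ¬Commute x y := by
  by_contra! hcomm
  have := Subgroup.isMulCommutative_closure hcomm
  exact hgh (setLike_mul_comm (s := Subgroup.closure S) (by simp [hS]) (by simp [hS]))

end GrowthBounds

section GoldenRatio

open scoped goldenRatio

theorem inv_goldenRatio_add_inv_goldenRatio_sq : φ⁻¹ + φ⁻¹ ^ 2 = 1 := by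
  have hne := Real.goldenRatio_ne_zero
  calc φ⁻¹ + φ⁻¹ ^ 2 = (φ + 1) * φ⁻¹ ^ 2 := by
        rw [add_mul, one_mul, sq, ← mul_assoc, mul_inv_cancel₀ hne, one_mul]
    _ = 1 := by rw [← Real.goldenRatio_sq, ← mul_pow, mul_inv_cancel₀ hne, one_pow]

-- Weighing a subset `t` by `φ⁻¹ ^ (#s + #t)` gives total weight `(φ⁻¹ * (φ⁻¹ + 1)) ^ #s = 1`, while
-- each of the counted subsets weighs at least `φ⁻¹ ^ m`.
open Finset in
theorem card_powerset_filter_le_goldenRatio_pow {α : Type*} (s : Finset α) (m : ℕ) :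
    (#{t ∈ s.powerset | #s + #t ≤ m} : ℝ) ≤ φ ^ m := by
  have hpos := inv_pos.2 Real.goldenRatio_pos
  have htotal : ∑ t ∈ s.powerset, φ⁻¹ ^ (#s + #t) = 1 := by
    calc ∑ t ∈ s.powerset, φ⁻¹ ^ (#s + #t)
        = φ⁻¹ ^ #s * ∑ t ∈ s.powerset, φ⁻¹ ^ #t * 1 ^ (#s - #t) := by
          simp only [pow_add, mul_sum, one_pow, mul_one]
      _ = (φ⁻¹ + φ⁻¹ ^ 2) ^ #s := by
          rw [sum_pow_mul_eq_add_pow, ← mul_pow, mul_add, mul_one, ← sq, add_comm]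
      _ = 1 := by rw [inv_goldenRatio_add_inv_goldenRatio_sq, one_pow]
  have hweight : #{t ∈ s.powerset | #s + #t ≤ m} * φ⁻¹ ^ m ≤ 1 := by
    calc #{t ∈ s.powerset | #s + #t ≤ m} * φ⁻¹ ^ m
        ≤ ∑ t ∈ s.powerset with #s + #t ≤ m, φ⁻¹ ^ (#s + #t) := by
          rw [← nsmul_eq_mul]
          exact card_nsmul_le_sum _ _ _ fun t ht => pow_le_pow_of_le_one hpos.le
            (inv_le_one_of_one_le₀ Real.one_lt_goldenRatio.le) (mem_filter.1 ht).2
      _ ≤ ∑ t ∈ s.powerset, φ⁻¹ ^ (#s + #t) :=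
          sum_le_sum_of_subset_of_nonneg (filter_subset _ _) fun _ _ _ => by positivity
      _ = 1 := htotal
  rwa [inv_pow, ← div_eq_mul_inv, div_le_one (pow_pos Real.goldenRatio_pos m)] at hweight

end GoldenRatio

namespace Lamplighter

variable {n : ℕ}

/-- The lamp configuration of an element of the lamplighter group, as an additive object. -/
def lamp (g : Lamplighter n) : ℤ →₀ ZMod n := g.left.toAdd

/-- The final position of the lamplighter, i.e. the image of the element in `ℤ`. -/
def pos (g : Lamplighter n) : ℤ := g.right.toAdd

theorem ext_lamp_pos {g h : Lamplighter n} (hl : ∀ i, lamp g i = lamp h i) (hp : pos g = pos h) :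
    g = h :=
  SemidirectProduct.ext (Multiplicative.toAdd.injective (Finsupp.ext hl))
    (Multiplicative.toAdd.injective hp)

theorem toAdd_shift_apply (k : Multiplicative ℤ) (f : Multiplicative (ℤ →₀ ZMod n)) (i : ℤ) :
    (shift n k f).toAdd i = f.toAdd (i - k.toAdd) := by
  change (Finsupp.domCongr (Equiv.addLeft k.toAdd) f.toAdd) i = _
  simp [Finsupp.domCongr_apply, Finsupp.equivMapDomain_apply, sub_eq_neg_add]

theorem shift_ofAdd_single (k : Multiplicative ℤ) (c : ZMod n) :
    shift n k (.ofAdd (Finsupp.single 0 c)) = .ofAdd (Finsupp.single k.toAdd c) := by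
  change Multiplicative.ofAdd (Finsupp.domCongr (Equiv.addLeft k.toAdd) (Finsupp.single 0 c)) = _
  simp [Finsupp.domCongr_apply]

@[simp] theorem pos_one : pos (1 : Lamplighter n) = 0 := rfl

@[simp] theorem pos_mul (g h : Lamplighter n) : pos (g * h) = pos g + pos h := rfl

@[simp] theorem pos_inv (g : Lamplighter n) : pos g⁻¹ = -pos g := rfl

@[simp] theorem pos_a : pos (a n) = 0 := rfl

@[simp] theorem pos_t : pos (t n) = 1 := rfl

@[simp] theorem lamp_one : lamp (1 : Lamplighter n) = 0 := rfl

@[simp] theorem lamp_mul_apply (g h : Lamplighter n) (i : ℤ) :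
    lamp (g * h) i = lamp g i + lamp h (i - pos g) := by
  change lamp g i + (shift n g.right h.left).toAdd i = _
  rw [toAdd_shift_apply]
  rfl

@[simp] theorem lamp_inv_apply (g : Lamplighter n) (i : ℤ) :
    lamp g⁻¹ i = -lamp g (i + pos g) := by
  have h := lamp_mul_apply g g⁻¹ (i + pos g)
  rw [mul_inv_cancel, add_sub_cancel_right] at h
  simp only [lamp_one, Finsupp.coe_zero, Pi.zero_apply] at h
  exact eq_neg_of_add_eq_zero_right h.symm

@[simp] theorem lamp_a : lamp (a n) = Finsupp.single 0 1 := rfl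

@[simp] theorem lamp_t : lamp (t n) = 0 := rfl

theorem inr_eq_t_zpow (k : Multiplicative ℤ) :
    (SemidirectProduct.inr k : Lamplighter n) = t n ^ k.toAdd := by
  rw [t, ← map_zpow, ← ofAdd_zsmul, smul_eq_mul, mul_one, ofAdd_toAdd]

theorem inl_ofAdd_single_eq_conj_a_zpow (i m : ℤ) :
    (SemidirectProduct.inl (.ofAdd (Finsupp.single i (m : ZMod n))) : Lamplighter n) =
      t n ^ i * a n ^ m * (t n ^ i)⁻¹ := by
  have ha : a n ^ m = SemidirectProduct.inl (.ofAdd (Finsupp.single 0 (m : ZMod n))) := by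
    rw [a, ← map_zpow, ← ofAdd_zsmul, Finsupp.smul_single, zsmul_one]
  rw [ha, ← toAdd_ofAdd i, ← shift_ofAdd_single, SemidirectProduct.inl_aut, map_inv, inr_eq_t_zpow]

theorem closure_a_t : Subgroup.closure {a n, t n} = ⊤ := by
  have ha : a n ∈ Subgroup.closure {a n, t n} := Subgroup.subset_closure (by simp)
  have ht : t n ∈ Subgroup.closure {a n, t n} := Subgroup.subset_closure (by simp)
  have hinl (f : ℤ →₀ ZMod n) :
      (SemidirectProduct.inl (.ofAdd f) : Lamplighter n) ∈ Subgroup.closure {a n, t n} := by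
    induction f using Finsupp.induction_linear with
    | zero => exact one_mem _
    | add f g hf hg =>
      rw [ofAdd_add, map_mul]
      exact mul_mem hf hg
    | single i c =>
      obtain ⟨m, rfl⟩ := ZMod.intCast_surjective c
      rw [inl_ofAdd_single_eq_conj_a_zpow]
      exact mul_mem (mul_mem (zpow_mem ht i) (zpow_mem ha m)) (inv_mem (zpow_mem ht i))
  refine eq_top_iff.2 fun g _ => ?_
  rw [← SemidirectProduct.inl_left_mul_inr_right g, inr_eq_t_zpow]
  exact mul_mem (hinl _) (zpow_mem ht _)

instance : Group.FG (Lamplighter n) :=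
  ⟨⟨{a n, t n}, by simpa using closure_a_t⟩⟩

theorem not_commute_a_t [Nontrivial (ZMod n)] : ¬Commute (a n) (t n) := fun h => by
  simpa [Finsupp.single_apply] using DFunLike.congr_fun (congrArg lamp h.eq) (0 : ℤ)

theorem commute_of_pos_eq_zero {g h : Lamplighter n} (hg : pos g = 0) (hh : pos h = 0) :
    Commute g h :=
  ext_lamp_pos (fun i => by simp [hg, hh, add_comm]) (add_comm _ _)

open scoped commutatorElement

theorem lamp_commutator_mul_apply (g h x : Lamplighter n) (i : ℤ) :
    lamp ⁅g * h, x⁆ i = lamp ⁅h, x⁆ (i - pos g) + lamp ⁅g, x⁆ i := by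
  have hpos : pos ⁅h, x⁆ = 0 := by simp [commutatorElement_def]
  rw [commutatorElement_mul_left_eq_conj_mul]
  simp [hpos]

/-- The submonoid of elements that do not move the lamplighter to the left and whose commutator
with `x` lights no lamp to the left of `e`. -/
def centralizerBelow (x : Lamplighter n) (e : ℤ) : Submonoid (Lamplighter n) where
  carrier := {g | 0 ≤ pos g ∧ ∀ i < e, lamp ⁅g, x⁆ i = 0}
  one_mem' := ⟨le_rfl, fun i _ => by simp⟩
  mul_mem' {g h} hg hh := ⟨add_nonneg hg.1 hh.1, fun i hi => by
    rw [lamp_commutator_mul_apply, hg.2 i hi, hh.2 _ (by linarith [hg.1]), add_zero]⟩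

-- Left multiplication by an element of positive position shifts the commutator of the other factor
-- to the right, past `e`, so the lamp of `⁅x * u, x⁆` at `e` is off and that of `⁅y * v, x⁆` is on.
open scoped Pointwise in
theorem disjoint_smul_centralizerBelow {x y : Lamplighter n} (hx : 0 < pos x) (hy : 0 < pos y)
    {e : ℤ} (he : lamp ⁅y, x⁆ e ≠ 0) :
    Disjoint (x • (centralizerBelow x e : Set (Lamplighter n)))
      (y • (centralizerBelow x e : Set (Lamplighter n))) := by
  refine Set.disjoint_left.2 ?_
  rintro _ ⟨u, hu, rfl⟩ ⟨v, hv, hvu : y * v = x * u⟩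
  have hlamp := lamp_commutator_mul_apply y v x e
  rw [hvu, lamp_commutator_mul_apply, hu.2 _ (by linarith), hv.2 _ (by linarith)] at hlamp
  exact he (by simpa using hlamp.symm)

theorem exists_lamp_ne_zero_of_ne_one {g : Lamplighter n} (hpos : pos g = 0) (hg : g ≠ 1) :
    ∃ e, lamp g e ≠ 0 ∧ ∀ i < e, lamp g i = 0 := by
  have hsupp : (lamp g).support.Nonempty := Finsupp.support_nonempty_iff.2 fun h =>
    hg (ext_lamp_pos (DFunLike.congr_fun h) hpos)
  refine ⟨(lamp g).support.min' hsupp, Finsupp.mem_support_iff.1 (Finset.min'_mem _ hsupp),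
    fun i hi => ?_⟩
  by_contra h
  exact (Finset.min'_le _ i (Finsupp.mem_support_iff.2 h)).not_gt hi

theorem exists_mem_wordBall_one_not_commute [Nontrivial (ZMod n)] {S : Set (Lamplighter n)}
    (hS : Subgroup.closure S = ⊤) :
    ∃ x ∈ wordBall S 1, ∃ y ∈ wordBall S 1, 0 < pos x ∧ 0 ≤ pos y ∧ ¬Commute x y := by
  obtain ⟨x, hx, y, hy, hxy⟩ := exists_not_commute_of_closure_eq_top hS (not_commute_a_t (n := n))
  replace hx := subset_wordBall_one S hx
  replace hy := subset_wordBall_one S hy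
  wlog hx0 : 0 ≤ pos x generalizing x
  · exact this x⁻¹ (by simpa using hxy) (inv_mem_wordBall hx) (by rw [pos_inv]; omega)
  wlog hy0 : 0 ≤ pos y generalizing y
  · exact this y⁻¹ (inv_mem_wordBall hy) (by simpa using hxy) (by rw [pos_inv]; omega)
  rcases hx0.lt_or_eq with hx1 | hx1
  · exact ⟨x, hx, y, hy, hx1, hy0, hxy⟩
  rcases hy0.lt_or_eq with hy1 | hy1
  · exact ⟨y, hy, x, hx, hy1, hx0, fun h => hxy h.symm⟩
  · exact absurd (commute_of_pos_eq_zero hx1.symm hy1.symm) hxy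

theorem le_growthRate_of_not_commute {S : Set (Lamplighter n)} (hS : S.Finite)
    {x y : Lamplighter n} (hx : 0 < pos x) (hy : 0 < pos y) (hxy : ¬Commute x y) {p q : ℕ}
    (hxS : x ∈ wordBall S p) (hyS : y ∈ wordBall S q) (hp : 0 < p) (hq : 0 < q)
    {r : ℝ} (hr : 1 ≤ r) (hpq : 1 ≤ r⁻¹ ^ p + r⁻¹ ^ q) : r ≤ growthRate S := by
  obtain ⟨e, he, hlt⟩ := exists_lamp_ne_zero_of_ne_one (g := ⁅y, x⁆)
    (by simp [commutatorElement_def])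
    (mt (fun h => (commutatorElement_eq_one_iff_commute.1 h).symm) hxy)
  exact le_growthRate_of_disjoint_smul hS (M := centralizerBelow x e) ⟨hx.le, by simp⟩ ⟨hy.le, hlt⟩
    (disjoint_smul_centralizerBelow hx hy he) hxS hyS hp hq hr hpq

open scoped goldenRatio in
theorem goldenRatio_le_growthRate [Nontrivial (ZMod n)] {S : Set (Lamplighter n)} (hS : S.Finite)
    (hgen : Subgroup.closure S = ⊤) : φ ≤ growthRate S := by
  obtain ⟨x, hx, y, hy, hx0, hy0, hxy⟩ := exists_mem_wordBall_one_not_commute hgen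
  -- Pairing `x` with `x * y` rather than `y` also covers the case where `y` does not move.
  have hxxy : ¬Commute x (x * y) := fun h =>
    hxy (by simpa using (Commute.refl x).inv_right.mul_right h)
  have hpos : 0 < pos (x * y) := add_pos_of_pos_of_nonneg hx0 hy0
  have hmem : x * y ∈ wordBall S 2 := mul_mem_wordBall hx hy
  exact le_growthRate_of_not_commute hS hx0 hpos hxxy hx hmem one_pos two_pos
    Real.one_lt_goldenRatio.le (by rw [pow_one, inv_goldenRatio_add_inv_goldenRatio_sq])

/-- The trace left on `g` by a walk of length `m` which visits exactly the positions in `[u, v]`: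
the walk needs `v - u` moves, and one switch for each lit lamp. -/
structure Sweeps (u v : ℤ) (m : ℕ) (g : Lamplighter n) : Prop where
  zero_mem : 0 ∈ Finset.Icc u v
  pos_mem : pos g ∈ Finset.Icc u v
  support_subset : (lamp g).support ⊆ Finset.Icc u v
  length_ge : v - u + (lamp g).support.card ≤ m

namespace Sweeps

theorem one : Sweeps 0 0 0 (1 : Lamplighter n) := ⟨by simp, by simp, by simp, by simp⟩

variable {u v : ℤ} {m : ℕ} {g x : Lamplighter n}

theorem mul_of_pos_eq_zero (h : Sweeps u v m g) (hpos : pos x = 0)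
    (hlamp : ∀ i ≠ 0, lamp x i = 0) : Sweeps u v (m + 1) (g * x) := by
  have hsub : (lamp (g * x)).support ⊆ insert (pos g) (lamp g).support := by
    intro i hi
    rw [Finset.mem_insert, Finsupp.mem_support_iff]
    rw [Finsupp.mem_support_iff, lamp_mul_apply] at hi
    by_contra! hoff
    exact hi (by rw [hoff.2, hlamp _ (sub_ne_zero.2 hoff.1), add_zero])
  have hcard := (Finset.card_le_card hsub).trans (Finset.card_insert_le _ _)
  have hlen := h.length_ge
  exact ⟨h.zero_mem, by simpa [hpos] using h.pos_mem,
    hsub.trans (Finset.insert_subset h.pos_mem h.support_subset), by push_cast; omega⟩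

theorem mul_of_lamp_eq_zero (h : Sweeps u v m g) (hpos : |pos x| = 1) (hlamp : lamp x = 0) :
    Sweeps (min u (pos g + pos x)) (max v (pos g + pos x)) (m + 1) (g * x) := by
  have heq : lamp (g * x) = lamp g := by
    ext i
    simp [hlamp]
  obtain ⟨hzero, hg, hsupp, hlen⟩ := h
  simp only [Finset.mem_Icc] at hzero hg
  have hmove := (abs_eq zero_le_one).1 hpos
  refine ⟨Finset.mem_Icc.2 (by omega), Finset.mem_Icc.2 (by rw [pos_mul]; omega), ?_, ?_⟩
  · rw [heq]
    exact hsupp.trans (Finset.Icc_subset_Icc (min_le_left _ _) (le_max_left _ _))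
  · rw [heq]
    push_cast
    omega

end Sweeps

theorem switch_or_move_of_mem {x : Lamplighter n}
    (hx : x ∈ ({a n, t n} : Set (Lamplighter n)) ∨ x⁻¹ ∈ ({a n, t n} : Set (Lamplighter n))) :
    (pos x = 0 ∧ ∀ i ≠ 0, lamp x i = 0) ∨ (|pos x| = 1 ∧ lamp x = 0) := by
  simp only [Set.mem_insert_iff, Set.mem_singleton_iff, inv_eq_iff_eq_inv] at hx
  rcases hx with (rfl | rfl) | (rfl | rfl)
  · exact Or.inl ⟨rfl, fun i hi => by simp [hi.symm]⟩
  · exact Or.inr ⟨rfl, rfl⟩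
  · exact Or.inl ⟨rfl, fun i hi => by simp [hi.symm]⟩
  · exact Or.inr ⟨rfl, by ext i; simp⟩

theorem exists_sweeps_of_mem_wordBall {g : Lamplighter n} {m : ℕ}
    (hg : g ∈ wordBall {a n, t n} m) : ∃ u v, Sweeps u v m g := by
  obtain ⟨l, hl, rfl, hlen⟩ := (wordLength_le_iff _ g m).1 hg
  suffices h : ∃ u v, Sweeps u v l.length l.prod by
    obtain ⟨u, v, h⟩ := h
    exact ⟨u, v, { h with length_ge := h.length_ge.trans (mod_cast hlen) }⟩
  clear hlen hg
  induction l using List.reverseRecOn with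
  | nil => exact ⟨0, 0, Sweeps.one⟩
  | append_singleton l x ih =>
    obtain ⟨u, v, h⟩ := ih fun y hy => hl y (by simp [hy])
    rw [List.prod_append, List.prod_singleton, List.length_append, List.length_singleton]
    rcases switch_or_move_of_mem (hl x (by simp)) with ⟨hpos, hlamp⟩ | ⟨hpos, hlamp⟩
    · exact ⟨_, _, h.mul_of_pos_eq_zero hpos hlamp⟩
    · exact ⟨_, _, h.mul_of_lamp_eq_zero hpos hlamp⟩

theorem injective_pos_support_lamp :
    Function.Injective fun g : Lamplighter 2 => (pos g, (lamp g).support) := by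
  intro g h hgh
  obtain ⟨hpos, hsupp⟩ := Prod.ext_iff.1 hgh
  have eq_of_ne_zero_iff : ∀ c d : ZMod 2, (c ≠ 0 ↔ d ≠ 0) → c = d := by decide
  refine ext_lamp_pos (fun i => eq_of_ne_zero_iff _ _ ?_) hpos
  rw [← Finsupp.mem_support_iff, ← Finsupp.mem_support_iff]
  exact iff_of_eq (congrArg (i ∈ ·) hsupp)

open Finset
open scoped goldenRatio

/-- The possible records `((u, v, p), s)` of a walk of length at most `m`: it visits the interval
`[u, v]`, ends at `p`, and leaves the lamps in `s` lit. The bound is `m + 1` since `[u, v]` contains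
one more position than the `v - u` moves needed to visit it. -/
noncomputable def sweepRecords (m : ℕ) : Finset (Σ _ : ℤ × ℤ × ℤ, Finset ℤ) :=
  (Icc (-m : ℤ) m ×ˢ Icc (-m : ℤ) m ×ˢ Icc (-m : ℤ) m).sigma fun r =>
    {s ∈ (Icc r.1 r.2.1).powerset | #(Icc r.1 r.2.1) + #s ≤ m + 1}

theorem Sweeps.mem_sweepRecords {u v : ℤ} {m : ℕ} {g : Lamplighter n} (h : Sweeps u v m g) :
    ⟨(u, v, pos g), (lamp g).support⟩ ∈ sweepRecords m := by
  obtain ⟨hzero, hpos, hsupp, hlen⟩ := h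
  simp only [mem_Icc] at hzero hpos
  simp only [sweepRecords, mem_sigma, mem_product, mem_filter, mem_powerset, mem_Icc, Int.card_Icc]
  exact ⟨by omega, hsupp, by omega⟩

theorem card_sweepRecords_le (m : ℕ) :
    (#(sweepRecords m) : ℝ) ≤ (2 * m + 1) ^ 3 * φ ^ (m + 1) := by
  have hI : #(Icc (-m : ℤ) m) = 2 * m + 1 := by
    rw [Int.card_Icc]
    omega
  rw [sweepRecords, card_sigma, Nat.cast_sum]
  refine (sum_le_card_nsmul _ _ _ fun r _ => card_powerset_filter_le_goldenRatio_pow _ _).trans_eq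
    ?_
  rw [card_product, card_product, hI, nsmul_eq_mul]
  push_cast
  ring

theorem growthFunction_a_t_le_card_sweepRecords (m : ℕ) :
    growthFunction {a 2, t 2} m ≤ #(sweepRecords m) := by
  choose! u v h using fun (g : Lamplighter 2) (hg : g ∈ wordBall {a 2, t 2} m) =>
    exists_sweeps_of_mem_wordBall hg
  rw [growthFunction_eq_ncard, ← Set.ncard_coe_finset]
  refine Set.ncard_le_ncard_of_injOn
    (fun g => (⟨(u g, v g, pos g), (lamp g).support⟩ : Σ _ : ℤ × ℤ × ℤ, Finset ℤ))
    (fun g hg => (h g hg).mem_sweepRecords) (fun g _ g' _ hgg' => ?_) (finite_toSet _)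
  simp only [Sigma.mk.injEq, Prod.mk.injEq, heq_eq_eq] at hgg'
  exact injective_pos_support_lamp (Prod.ext hgg'.1.2.2 hgg'.2)

theorem growthRate_a_t_le : growthRate {a 2, t 2} ≤ φ := by
  have hφ := Real.goldenRatio_pos
  refine growthRate_le_of_eventually_le (by simp) (c := 27 * φ) (by positivity) hφ.le 3 ?_
  filter_upwards [eventually_ge_atTop 1] with m hm
  have hm' : (1 : ℝ) ≤ m := mod_cast hm
  calc (growthFunction {a 2, t 2} m : ℝ) ≤ #(sweepRecords m) :=
        mod_cast growthFunction_a_t_le_card_sweepRecords m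
    _ ≤ (2 * m + 1) ^ 3 * φ ^ (m + 1) := card_sweepRecords_le m
    _ ≤ (3 * m) ^ 3 * φ ^ (m + 1) := by
        gcongr
        linarith
    _ = 27 * φ * (m : ℝ) ^ 3 * φ ^ m := by ring

end Lamplighter

section AscendingHNN

/-- An injective endomorphism of `H`, as an isomorphism between the subgroups `H` and `f(H)` of
`H`. -/
noncomputable def ascendingEquiv {H : Type*} [Group H] (f : H →* H) (hf : Function.Injective f) :
    (⊤ : Subgroup H) ≃* f.range :=
  Subgroup.topEquiv.trans (MonoidHom.ofInjective hf)

/-- The ascending HNN extension of `H` along an injective endomorphism `f`: its stable letter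
conjugates all of `H` into `H`, acting as `f`. -/
abbrev AscendingHNN {H : Type*} [Group H] (f : H →* H) (hf : Function.Injective f) : Type _ :=
  HNNExtension H ⊤ f.range (ascendingEquiv f hf)

namespace AscendingHNN

open HNNExtension

variable {H G : Type*} [Group H] [Group G] {f : H →* H} {hf : Function.Injective f}

theorem semiconjBy_t_pow_of (m : ℕ) (k : H) :
    SemiconjBy (t ^ m : AscendingHNN f hf) (of k) (of (f^[m] k)) := by
  induction m with
  | zero => simp
  | succ m ih =>
    have ht : SemiconjBy (t : AscendingHNN f hf) (of (f^[m] k)) (of (f (f^[m] k))) :=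
      t_mul_of (φ := ascendingEquiv f hf) ⟨f^[m] k, Subgroup.mem_top _⟩
    rw [pow_succ', Function.iterate_succ_apply']
    exact ht.mul_left ih

theorem exists_t_pow_mul_eq_of_mul_t_pow (g : AscendingHNN f hf) :
    ∃ (i j : ℕ) (k : H), t ^ i * g = of k * t ^ j := by
  induction g using HNNExtension.induction_on with
  | of k => exact ⟨0, 0, k, by simp⟩
  | t => exact ⟨0, 1, 1, by simp⟩
  | mul x y hx hy =>
    obtain ⟨i, j, k, hx⟩ := hx
    obtain ⟨i', j', k', hy⟩ := hy
    refine ⟨i' + i, j + j', f^[i'] k * f^[j] k', ?_⟩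
    calc t ^ (i' + i) * (x * y) = t ^ i' * of k * t ^ j * y := by
          rw [pow_add, mul_assoc, ← mul_assoc (t ^ i), hx]
          simp only [mul_assoc]
      _ = of (f^[i'] k) * t ^ j * (t ^ i' * y) := by
          rw [(semiconjBy_t_pow_of i' k).eq, mul_assoc _ (t ^ i'), ← pow_add, add_comm i', pow_add]
          simp only [mul_assoc]
      _ = of (f^[i'] k) * (t ^ j * of k') * t ^ j' := by
          rw [hy]
          simp only [mul_assoc]
      _ = of (f^[i'] k * f^[j] k') * t ^ (j + j') := by
          rw [(semiconjBy_t_pow_of j k').eq, map_mul, pow_add]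
          simp only [mul_assoc]
  | inv x hx =>
    obtain ⟨i, j, k, hx⟩ := hx
    refine ⟨j, i, k⁻¹, ?_⟩
    rw [mul_inv_eq_iff_eq_mul, mul_assoc, hx, map_inv, inv_mul_cancel_left]

theorem injective_of_comp_of_injective (F : AscendingHNN f hf →* G)
    (hinj : Function.Injective (F.comp of))
    (hpow : ∀ m : ℤ, F t ^ m ∈ (F.comp of).range → m = 0) : Function.Injective F := by
  refine (injective_iff_map_eq_one F).2 fun g hg => ?_
  obtain ⟨i, j, k, hk⟩ := exists_t_pow_mul_eq_of_mul_t_pow g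
  have hFk : F (of k) = F t ^ (i - j : ℤ) := by
    have h := congrArg F hk
    rw [map_mul, map_mul, hg, mul_one, map_pow, map_pow] at h
    rw [zpow_sub, zpow_natCast, zpow_natCast, h, mul_inv_cancel_right]
  have hij : i = j := by
    have := hpow _ ⟨k, hFk⟩
    omega
  have hk1 : k = 1 := hinj (by simpa [hij] using hFk)
  simpa [hij, hk1] using hk

end AscendingHNN

open scoped Pointwise

variable {G : Type*} [Group G] {K : Subgroup G} {s : G}

theorem eq_zero_of_zpow_mem_of_conj_smul_lt (hlt : MulAut.conj s • K < K) {m : ℤ}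
    (hm : s ^ m ∈ K) : m = 0 := by
  have hanti : StrictAnti fun i : ℕ => MulAut.conj s ^ i • K := by
    refine strictAnti_nat_of_succ_lt fun i => ?_
    rw [pow_succ, mul_smul]
    simpa only [lt_iff_le_not_ge, Subgroup.pointwise_smul_le_pointwise_smul_iff] using hlt
  have hmem : s ^ m.natAbs ∈ K := by
    obtain ⟨k, rfl | rfl⟩ := m.eq_nat_or_neg <;> simpa using hm
  have hfix : MulAut.conj s ^ m.natAbs • K = MulAut.conj s ^ 0 • K := by
    rw [← map_pow, Subgroup.conj_smul_eq_self_of_mem hmem, pow_zero, one_smul]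
  exact Int.natAbs_eq_zero.1 (hanti.injective hfix)

/-- Conjugation by `s`, as an endomorphism of a subgroup `K` with `s K s⁻¹ ≤ K`. -/
def conjEnd (h : MulAut.conj s • K ≤ K) : K →* K :=
  ((MulAut.conj s).toMonoidHom.comp K.subtype).codRestrict K fun k =>
    h (Subgroup.smul_mem_pointwise_smul _ _ K k.2)

theorem coe_conjEnd_apply (h : MulAut.conj s • K ≤ K) (k : K) :
    (conjEnd h k : G) = s * k * s⁻¹ :=
  rfl

theorem conjEnd_injective (h : MulAut.conj s • K ≤ K) : Function.Injective (conjEnd h) :=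
  fun _ _ hxy => Subtype.ext ((MulAut.conj s).injective (congrArg Subtype.val hxy))

theorem conjEnd_range_ne_top (h : MulAut.conj s • K < K) : (conjEnd h.le).range ≠ ⊤ := by
  intro htop
  refine h.not_ge fun k hk => ?_
  obtain ⟨k₀, hk₀⟩ : (⟨k, hk⟩ : K) ∈ (conjEnd h.le).range := htop ▸ Subgroup.mem_top _
  exact ⟨k₀, k₀.2, congrArg Subtype.val hk₀⟩

theorem isNonSemidirectHNN_of_conj_smul_lt (hlt : MulAut.conj s • K < K)
    (hgen : Subgroup.closure (insert s (K : Set G)) = ⊤) : IsNonSemidirectHNN G := by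
  let φ := ascendingEquiv (conjEnd hlt.le) (conjEnd_injective hlt.le)
  have hconj (k : (⊤ : Subgroup K)) : s * K.subtype k = K.subtype (φ k) * s := by
    change s * (k : G) = (conjEnd hlt.le k : G) * s
    rw [coe_conjEnd_apply, inv_mul_cancel_right]
  let F : AscendingHNN (conjEnd hlt.le) (conjEnd_injective hlt.le) →* G :=
    HNNExtension.lift K.subtype s hconj
  have hFt : F HNNExtension.t = s := HNNExtension.lift_t K.subtype s hconj
  have hF_of (k : K) : F (HNNExtension.of k) = k := HNNExtension.lift_of K.subtype s hconj k
  have hFof : F.comp HNNExtension.of = K.subtype := MonoidHom.ext hF_of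
  have hinj : Function.Injective F := by
    refine AscendingHNN.injective_of_comp_of_injective F ?_ fun m hm => ?_
    · rw [hFof]
      exact K.subtype_injective
    · rw [hFt, hFof, K.range_subtype] at hm
      exact eq_zero_of_zpow_mem_of_conj_smul_lt hlt hm
  have hsurj : Function.Surjective F := by
    rw [← MonoidHom.range_eq_top, eq_top_iff, ← hgen, Subgroup.closure_le]
    rintro x (rfl | hx)
    · exact ⟨_, hFt⟩
    · exact ⟨_, hF_of ⟨x, hx⟩⟩
  exact ⟨K, inferInstance, ⊤, _, _, Or.inr (conjEnd_range_ne_top hlt),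
    ⟨(MulEquiv.ofBijective F ⟨hinj, hsurj⟩).symm⟩⟩

end AscendingHNN

namespace Lamplighter

variable {n : ℕ}

/-- The subgroup of lamp configurations supported on the nonnegative positions. -/
def nonnegLamps (n : ℕ) : Subgroup (Lamplighter n) where
  carrier := {g | pos g = 0 ∧ ∀ i < 0, lamp g i = 0}
  one_mem' := ⟨rfl, fun _ _ => rfl⟩
  mul_mem' {g h} hg hh :=
    ⟨by simp [hg.1, hh.1], fun i hi => by simp [hg.1, hg.2 i hi, hh.2 i hi]⟩
  inv_mem' {g} hg := ⟨by simp [hg.1], fun i hi => by simp [hg.1, hg.2 i hi]⟩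

theorem a_mem_nonnegLamps : a n ∈ nonnegLamps n := ⟨rfl, fun i hi => by simp [hi.ne']⟩

open scoped Pointwise in
theorem conj_t_smul_nonnegLamps_lt [Nontrivial (ZMod n)] :
    MulAut.conj (t n) • nonnegLamps n < nonnegLamps n := by
  refine SetLike.lt_iff_le_and_exists.2 ⟨?_, a n, a_mem_nonnegLamps, fun h => ?_⟩
  · rintro _ ⟨k, ⟨hpos, hlamp⟩, rfl⟩
    refine ⟨?_, fun i hi => ?_⟩
    · simp [hpos]
    · simp [hlamp (i - 1) (by omega)]
  · rw [Subgroup.mem_pointwise_smul_iff_inv_smul_mem, ← map_inv] at h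
    simpa [Finsupp.single_apply] using h.2 (-1) (by norm_num)

theorem isNonSemidirectHNN [Nontrivial (ZMod n)] : IsNonSemidirectHNN (Lamplighter n) := by
  refine isNonSemidirectHNN_of_conj_smul_lt conj_t_smul_nonnegLamps_lt (eq_top_iff.2 ?_)
  rw [← closure_a_t]
  refine Subgroup.closure_mono ?_
  rintro x (rfl | rfl)
  exacts [Or.inr a_mem_nonnegLamps, Or.inl rfl]

theorem isLeast_growthRate_a_t :
    IsLeast {r : ℝ | ∃ S : Set (Lamplighter 2), S.Finite ∧ Subgroup.closure S = ⊤ ∧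
      growthRate S = r} (growthRate {a 2, t 2}) :=
  ⟨⟨_, by simp, closure_a_t, rfl⟩, by
    rintro _ ⟨S, hS, hgen, rfl⟩
    exact growthRate_a_t_le.trans (goldenRatio_le_growthRate hS hgen)⟩

end Lamplighter

theorem proposition8 :
    Subgroup.closure {Lamplighter.a 2, Lamplighter.t 2} = ⊤ ∧
    growthRate {Lamplighter.a 2, Lamplighter.t 2} = minimalGrowthRate (Lamplighter 2) ∧
    minimalGrowthRate (Lamplighter 2) = (1 + Real.sqrt 5) / 2 ∧
    IsNonSemidirectHNN (Lamplighter 2) ∧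
    (∀ c : ℝ, (∀ (G : Type) [Group G] [Group.FG G], IsNonSemidirectHNN G →
      c ≤ minimalGrowthRate G) → c ≤ (1 + Real.sqrt 5) / 2) := by
  have hmin : minimalGrowthRate (Lamplighter 2) = growthRate {Lamplighter.a 2, Lamplighter.t 2} :=
    Lamplighter.isLeast_growthRate_a_t.csInf_eq
  have hval : minimalGrowthRate (Lamplighter 2) = (1 + Real.sqrt 5) / 2 :=
    hmin.trans (le_antisymm Lamplighter.growthRate_a_t_le
      (Lamplighter.goldenRatio_le_growthRate (by simp) Lamplighter.closure_a_t))
  exact ⟨Lamplighter.closure_a_t, hmin.symm, hval, Lamplighter.isNonSemidirectHNN,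
    fun c hc => hval ▸ hc (Lamplighter 2) Lamplighter.isNonSemidirectHNN⟩
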